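/- Let $n\ge 2$ and $0\le k\le n-2$, let $\Omega\subset\mathbb R^n$ be a bounded open set, and let $E\subset\mathbb R^n$ be a smooth closed (that is, compact and without boundary) $k$-dimensional embedded submanifold of $\mathbb R^n$; $E$ need not be connected or contained in $\Omega$. For an open set $U\subset\mathbb R^n$ and $1\le m\le n$, a function $u:U\to\mathbb R\cup\{+\infty\}$ is called viscosity $m$-superaffine in $U$ if it is lower semicontinuous, $\inf_U u>-\infty$, and for every $\varphi\in C^2(U)$ with $\varphi\le u$ in $U$ and every $\bar x\in U$ with $\varphi(\bar x)=u(\bar x)$ one has $$\lambda_1(\nabla^2\varphi(\bar x))+\cdots+\lambda_m(\nabla^2\varphi(\bar x))\le 0,$$ where $\lambda_1\le\lambda_2\le\cdots\le\lambda_n$ are the eigenvalues of the Hessian, in increasing order and counted with multiplicity. Suppose that $u$ is viscosity $(k+2)$-superaffine in $\Omega\setminus E$, and extend $u$ to $\Omega$ by setting $$u(y):=\liminf_{x\to y,\ x\in\Omega\setminus E}u(x)\in\mathbb R\cup\{+\infty\}\qquad (y\in E\cap\Omega).$$ Then the extended function $u$ is viscosity $1$-superaffine in $\Omega$. -/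

import Mathlib

open Filter Topology Set
open scoped ContDiff

noncomputable section

/-- The Hessian matrix `(∂ᵢ∂ⱼ φ (x))ᵢⱼ` of a real function on `ℝⁿ`. -/
def hessianMatrix {n : ℕ} (φ : EuclideanSpace ℝ (Fin n) → ℝ) (x : EuclideanSpace ℝ (Fin n)) :
    Matrix (Fin n) (Fin n) ℝ :=
  Matrix.of fun i j =>
    fderiv ℝ (fderiv ℝ φ) x (EuclideanSpace.single i (1 : ℝ)) (EuclideanSpace.single j (1 : ℝ))

/-- The real eigenvalues `λ₁ ≤ λ₂ ≤ ⋯` of a matrix, listed in increasing order, each repeated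
according to its algebraic multiplicity. For a symmetric `n × n` matrix the list has length `n`. -/
def orderedEigenvalues {n : ℕ} (A : Matrix (Fin n) (Fin n) ℝ) : List ℝ :=
  A.charpoly.roots.sort (· ≤ ·)

/-- `λ₁ + ⋯ + λ_k`, the sum of the first `k` eigenvalues in increasing order. -/
def sumSmallestEigenvalues {n : ℕ} (k : ℕ) (A : Matrix (Fin n) (Fin n) ℝ) : ℝ :=
  ((orderedEigenvalues A).take k).sum

/-- Viscosity `k`-superaffine functions on an open set `Ω ⊆ ℝⁿ` (`1 ≤ k ≤ n`): lower
semicontinuous functions, bounded below on `Ω` (so with values in `ℝ ∪ {+∞}`), such that every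
`C²` function touching from below has `λ₁ + ⋯ + λ_k ≤ 0` at each contact point. Only the
values of `u` on `Ω` matter. -/
structure IsViscositySuperaffine {n : ℕ} (k : ℕ) (Ω : Set (EuclideanSpace ℝ (Fin n)))
    (u : EuclideanSpace ℝ (Fin n) → EReal) : Prop where
  lowerSemicontinuousOn : LowerSemicontinuousOn u Ω
  bddBelow : ∃ c : ℝ, ∀ x ∈ Ω, (c : EReal) ≤ u x
  hessian_le : ∀ φ : EuclideanSpace ℝ (Fin n) → ℝ, ContDiffOn ℝ 2 φ Ω →
    (∀ x ∈ Ω, (φ x : EReal) ≤ u x) →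
    ∀ x₀ ∈ Ω, (φ x₀ : EReal) = u x₀ → sumSmallestEigenvalues k (hessianMatrix φ x₀) ≤ 0

/-- `E` is a smooth closed (compact, without boundary) `k`-dimensional embedded submanifold of
`ℝⁿ`: it is compact, and near each of its points a smooth local diffeomorphism of `ℝⁿ` carries it
to the coordinate subspace `{z | z_i = 0 for the last n - k indices i}`. -/
structure IsSmoothClosedSubmanifold {n : ℕ} (k : ℕ) (E : Set (EuclideanSpace ℝ (Fin n))) :
    Prop where
  isCompact : IsCompact E
  exists_slice_chart : ∀ p ∈ E,
    ∃ Φ : OpenPartialHomeomorph (EuclideanSpace ℝ (Fin n)) (EuclideanSpace ℝ (Fin n)),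
      p ∈ Φ.source ∧ ContDiffOn ℝ ∞ Φ Φ.source ∧ ContDiffOn ℝ ∞ Φ.symm Φ.target ∧
      ∀ x ∈ Φ.source, x ∈ E ↔ ∀ i : Fin n, k ≤ (i : ℕ) → Φ x i = 0

open Classical in
/-- The extension to `E` of a function `u` on `Ω \ E`:
`u(y) := liminf u(x)` as `x → y`, `x ∈ Ω \ E`, for `y ∈ E`. -/
def liminfExtension {n : ℕ} (Ω E : Set (EuclideanSpace ℝ (Fin n)))
    (u : EuclideanSpace ℝ (Fin n) → EReal) : EuclideanSpace ℝ (Fin n) → EReal :=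
  fun y => if y ∈ E then liminf u (𝓝[Ω \ E] y) else u y

end

/-! Off `E`, a test function for the extension is one for `u`, and `λ₁ + ⋯ + λ_{k+2} ≤ 0` forces `λ₁
≤ 0`. Suppose instead that `φ` touches at `x₀ ∈ E` with `λ₁(∇²φ(x₀)) > 0`. For small `c > 0` the
function `φ - c‖x - x₀‖²` is still convex near `x₀`, and it lies below `u` with a gap on small
spheres. With `d` the distance to `E`, add `ε (log d² + A d)`, which tends to `-∞` on `E`: some
translate then touches `u` at a point off `E` but close to `x₀` (`exists_touching_logBarrier`).

The barrier makes this contact impossible. Among `k + 2` orthonormal directions the tangent space of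
`E` absorbs at most `k`, leaving two normal dimensions' worth. Since `log ‖·‖²` is harmonic in the
plane, the leading `1/d²` terms of the trace are nonnegative; the curvature of `E` costs `O(1/d)`,
which `A d` outweighs (`sum_fderiv_fderiv_logBarrier_pos`). Hence the sum of the `k + 2` smallest
eigenvalues is positive at the contact point.

Smoothness of `d²` is never needed: near the contact point it is replaced by a quadratic polynomial
that bounds it from below with equality there (`eventually_norm_sq_sub_le_infDist_sq`). -/

/-! ### Eigenvalue sums and Hessians -/

/-- The `m` smallest eigenvalues of a symmetric matrix are Rayleigh quotients of an orthonormal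
family. -/
theorem exists_orthonormal_sum_eq_sumSmallestEigenvalues {n m : ℕ} (hm : m ≤ n)
    {A : Matrix (Fin n) (Fin n) ℝ} (hA : A.IsHermitian) :
    ∃ v : Fin m → EuclideanSpace ℝ (Fin n), Orthonormal ℝ v ∧
      ∑ i, inner ℝ (v i) (Matrix.toEuclideanLin A (v i)) = sumSmallestEigenvalues m A := by
  have hroots : A.charpoly.roots = Multiset.map hA.eigenvalues Finset.univ.val := by
    simpa using hA.roots_charpoly_eq_eigenvalues
  have hperm : (orderedEigenvalues A).Perm (Finset.univ.toList.map hA.eigenvalues) := by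
    rw [← Multiset.coe_eq_coe, orderedEigenvalues, Multiset.sort_eq, hroots, ← Multiset.map_coe,
      Finset.coe_toList]
  have hlen : (orderedEigenvalues A).length = n := by simpa using hperm.length_eq
  -- Lifting the first `m` eigenvalues to distinct indices gives repeated eigenvalues different
  -- eigenvectors.
  obtain ⟨l, hl, hls⟩ := (List.take_sublist m (orderedEigenvalues A)).subperm.trans hperm.subperm
  obtain ⟨l', hl', rfl⟩ := List.sublist_map_iff.1 hls
  have hnd : l'.Nodup := hl'.nodup (Finset.nodup_toList _)
  have hl'm : l'.length = m := by
    have := hl.length_eq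
    simp only [List.length_map, List.length_take, hlen] at this
    omega
  subst hl'm
  refine ⟨fun i => hA.eigenvectorBasis (l'.get i),
    hA.eigenvectorBasis.orthonormal.comp _ (List.nodup_iff_injective_get.1 hnd), ?_⟩
  rw [sumSmallestEigenvalues, ← hl.sum_eq, ← List.sum_ofFn]
  congr 1
  apply List.ext_get (by simp)
  intro i h₁ h₂
  have hi : i < l'.length := by simpa using h₂
  simp only [List.get_eq_getElem, List.getElem_ofFn, List.getElem_map]
  have : Matrix.toEuclideanLin A (hA.eigenvectorBasis (l'[i]'hi)) =
      hA.eigenvalues (l'[i]'hi) • hA.eigenvectorBasis (l'[i]'hi) := by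
    ext j
    simpa using congrFun (hA.mulVec_eigenvectorBasis (l'[i]'hi)) j
  rw [this, inner_smul_right, real_inner_self_eq_norm_sq, hA.eigenvectorBasis.norm_eq_one]
  simp

/-- The smallest eigenvalue bounds the Rayleigh quotient from below. -/
theorem sumSmallestEigenvalues_one_mul_sq_norm_le {n : ℕ}
    {A : Matrix (Fin n) (Fin n) ℝ} (hA : A.IsHermitian) (v : EuclideanSpace ℝ (Fin n)) :
      sumSmallestEigenvalues 1 A * ‖v‖ ^ 2 ≤ inner ℝ v (Matrix.toEuclideanLin A v) := by
  have hroots : A.charpoly.roots = Multiset.map hA.eigenvalues Finset.univ.val := by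
    simpa using hA.roots_charpoly_eq_eigenvalues
  have hle : ∀ i, sumSmallestEigenvalues 1 A ≤ hA.eigenvalues i := by
    intro i
    have hi : hA.eigenvalues i ∈ orderedEigenvalues A := by
      simp [orderedEigenvalues, hroots]
    have hs : (orderedEigenvalues A).Pairwise (· ≤ ·) := Multiset.pairwise_sort _ _
    unfold sumSmallestEigenvalues
    cases hl : orderedEigenvalues A with
    | nil => simp [hl] at hi
    | cons a l =>
      rw [hl] at hi hs
      rcases List.mem_cons.1 hi with hi | hi
      · simp [hi]
      · simpa using List.rel_of_pairwise_cons hs hi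
  have happ : ∀ i, Matrix.toEuclideanLin A (hA.eigenvectorBasis i) =
      hA.eigenvalues i • hA.eigenvectorBasis i := by
    intro i
    ext j
    simpa using congrFun (hA.mulVec_eigenvectorBasis i) j
  have hsymm := Matrix.isSymmetric_toEuclideanLin_iff.2 hA
  rw [← hA.eigenvectorBasis.sum_inner_mul_inner, ← hA.eigenvectorBasis.sum_sq_norm_inner_right v,
    Finset.mul_sum]
  refine Finset.sum_le_sum fun i _ => ?_
  rw [← hsymm, happ, inner_smul_left, real_inner_comm v]
  simp only [Real.norm_eq_abs, sq_abs, conj_trivial]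
  nlinarith [mul_le_mul_of_nonneg_right (hle i)
    (sq_nonneg (inner ℝ v (hA.eigenvectorBasis i)))]

theorem sumSmallestEigenvalues_one_nonpos {n m : ℕ} (hm : 1 ≤ m) {A : Matrix (Fin n) (Fin n) ℝ}
    (h : sumSmallestEigenvalues m A ≤ 0) : sumSmallestEigenvalues 1 A ≤ 0 := by
  by_contra! hpos
  unfold sumSmallestEigenvalues at h hpos
  have hs : (orderedEigenvalues A).Pairwise (· ≤ ·) := Multiset.pairwise_sort _ _
  cases hl : orderedEigenvalues A with
  | nil => simp [hl] at hpos
  | cons a l =>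
    obtain ⟨m, rfl⟩ := Nat.exists_eq_add_of_le' hm
    rw [hl] at h hpos hs
    simp only [List.take_succ_cons, List.take_zero, List.sum_cons, List.sum_nil, add_zero] at h hpos
    have : 0 ≤ (l.take m).sum := List.sum_nonneg fun x hx =>
      hpos.le.trans (List.rel_of_pairwise_cons hs (List.mem_of_mem_take hx))
    linarith

section Hessian

variable {n : ℕ} {φ : EuclideanSpace ℝ (Fin n) → ℝ} {x : EuclideanSpace ℝ (Fin n)}

theorem hessianMatrix_isHermitian (h : ContDiffAt ℝ 2 φ x) : (hessianMatrix φ x).IsHermitian := by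
  ext i j
  have := h.isSymmSndFDerivAt (by simp)
  simpa [hessianMatrix] using this _ _

theorem inner_toEuclideanLin_hessianMatrix (v w : EuclideanSpace ℝ (Fin n)) :
    inner ℝ v (Matrix.toEuclideanLin (hessianMatrix φ x) w) = fderiv ℝ (fderiv ℝ φ) x v w := by
  have hv : ∀ v : EuclideanSpace ℝ (Fin n), v = ∑ i, v i • EuclideanSpace.single i (1 : ℝ) := by
    intro v
    ext j
    simp [Finset.sum_apply, Pi.single_apply]
  conv_rhs => rw [hv v, hv w]
  simp only [map_sum, map_smul, FunLike.coe_sum, FunLike.coe_smul,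
    Finset.sum_apply, Pi.smul_apply, smul_eq_mul, PiLp.inner_apply]
  simp [Matrix.toLpLin_apply, Matrix.mulVec, dotProduct, hessianMatrix, Finset.sum_mul,
    Finset.mul_sum]
  refine (Finset.sum_comm).trans ?_
  exact Finset.sum_congr rfl fun i _ => Finset.sum_congr rfl fun j _ => by ring

end Hessian

/-! ### Localization of test functions -/

/-- Functions touching a superaffine function from below only locally may be used as test
functions. -/
theorem IsViscositySuperaffine.hessian_le_of_eventually {n k : ℕ}
    {U : Set (EuclideanSpace ℝ (Fin n))} {u : EuclideanSpace ℝ (Fin n) → EReal}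
    (hu : IsViscositySuperaffine k U u) {ψ : EuclideanSpace ℝ (Fin n) → ℝ}
    {x₀ : EuclideanSpace ℝ (Fin n)} (hx₀ : x₀ ∈ U) (hψ : ContDiffAt ℝ 2 ψ x₀)
    (hle : ∀ᶠ x in 𝓝 x₀, (ψ x : EReal) ≤ u x) (heq : (ψ x₀ : EReal) = u x₀) :
    sumSmallestEigenvalues k (hessianMatrix ψ x₀) ≤ 0 := by
  obtain ⟨c, hc⟩ := hu.bddBelow
  obtain ⟨ρ, hρ, hball⟩ := Metric.eventually_nhds_iff_ball.1
    (hle.and (hψ.eventually (by simp)))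
  let χ : ContDiffBump x₀ := ⟨ρ / 4, ρ / 2, by positivity, by linarith⟩
  -- A convex combination of `ψ` and the global lower bound `c` of `u` stays below `u` wherever `ψ`
  -- does, and equals `c` away from `x₀`.
  let φ : EuclideanSpace ℝ (Fin n) → ℝ := fun x => χ x * ψ x + (1 - χ x) * c
  have hχ : ContDiff ℝ 2 χ := χ.contDiff
  have hφ : ContDiff ℝ 2 φ := by
    rw [contDiff_iff_contDiffAt]
    intro x
    by_cases hx : x ∈ Metric.ball x₀ ρ
    · exact (hχ.contDiffAt.mul (hball x hx).2).add
        ((contDiffAt_const.sub hχ.contDiffAt).mul contDiffAt_const)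
    · have hx' : x ∉ tsupport χ := by
        rw [χ.tsupport_eq]
        intro h
        have h₁ : dist x x₀ ≤ ρ / 2 := h
        exact hx (Metric.mem_ball.2 (by linarith))
      have : φ =ᶠ[𝓝 x] fun _ => c := by
        filter_upwards [notMem_tsupport_iff_eventuallyEq.1 hx'] with z hz
        have hz' : χ z = 0 := hz
        simp [φ, hz']
      exact contDiffAt_const.congr_of_eventuallyEq this
  have hφψ : φ =ᶠ[𝓝 x₀] ψ := by
    filter_upwards [χ.eventuallyEq_one] with z hz
    have hz' : χ z = 1 := hz
    simp [φ, hz']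
  have key : hessianMatrix φ x₀ = hessianMatrix ψ x₀ := by
    unfold hessianMatrix
    rw [hφψ.fderiv.fderiv_eq]
  rw [← key]
  refine hu.hessian_le φ hφ.contDiffOn (fun x hx => ?_) x₀ hx₀ (by rw [hφψ.eq_of_nhds, heq])
  by_cases hxb : x ∈ Metric.ball x₀ ρ
  · have h : φ x ≤ max (ψ x) c := by
      have h₀ := χ.nonneg (x := x)
      have h₁ := χ.le_one (x := x)
      have h₂ := mul_le_mul_of_nonneg_left (le_max_left (ψ x) c) h₀
      have h₃ := mul_le_mul_of_nonneg_left (le_max_right (ψ x) c) (sub_nonneg.2 h₁)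
      simp only [φ]
      linarith
    rcases max_choice (ψ x) c with h' | h' <;> rw [h'] at h
    · exact (EReal.coe_le_coe_iff.2 h).trans (hball x hxb).1
    · exact (EReal.coe_le_coe_iff.2 h).trans (hc x hx)
  · have : χ x = 0 := χ.zero_of_le_dist (by
      have : ρ ≤ dist x x₀ := not_lt.1 hxb
      change ρ / 2 ≤ _
      linarith)
    simpa [φ, this] using hc x hx

/-! ### The liminf extension -/

section Extension

variable {n : ℕ} {Ω E : Set (EuclideanSpace ℝ (Fin n))} {u : EuclideanSpace ℝ (Fin n) → EReal}

theorem liminfExtension_of_notMem {y : EuclideanSpace ℝ (Fin n)} (hy : y ∉ E) :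
    liminfExtension Ω E u y = u y := if_neg hy

theorem liminfExtension_of_mem {y : EuclideanSpace ℝ (Fin n)} (hy : y ∈ E) :
    liminfExtension Ω E u y = liminf u (𝓝[Ω \ E] y) := if_pos hy

theorem lowerSemicontinuousOn_liminfExtension (hΩ : IsOpen Ω) (hE : IsClosed E)
    (hu : LowerSemicontinuousOn u (Ω \ E)) :
    LowerSemicontinuousOn (liminfExtension Ω E u) Ω := by
  intro y hy c hc
  rw [hΩ.nhdsWithin_eq hy]
  by_cases hyE : y ∈ E
  · rw [liminfExtension_of_mem hyE] at hc
    obtain ⟨c', hcc', hc'⟩ := exists_between hc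
    have h := eventually_lt_of_lt_liminf hc'
    rw [eventually_nhdsWithin_iff, eventually_nhds_iff] at h
    obtain ⟨W, hW, hWo, hyW⟩ := h
    filter_upwards [(hWo.inter hΩ).mem_nhds ⟨hyW, hy⟩] with z hz
    by_cases hzE : z ∈ E
    · rw [liminfExtension_of_mem hzE]
      refine hcc'.trans_le (le_liminf_of_le (by isBoundedDefault) ?_)
      rw [eventually_nhdsWithin_iff]
      filter_upwards [hWo.mem_nhds hz.1] with w hw hw' using (hW w hw hw').le
    · rw [liminfExtension_of_notMem hzE]
      exact hcc'.trans (hW z hz.1 ⟨hz.2, hzE⟩)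
  · rw [liminfExtension_of_notMem hyE] at hc
    have ho : IsOpen (Ω \ E) := hΩ.sdiff hE
    have h := hu y ⟨hy, hyE⟩ c hc
    rw [ho.nhdsWithin_eq ⟨hy, hyE⟩] at h
    filter_upwards [h, ho.mem_nhds ⟨hy, hyE⟩] with z hz hz'
    rwa [liminfExtension_of_notMem hz'.2]

theorem le_liminfExtension {c : EReal} (hc : ∀ x ∈ Ω \ E, c ≤ u x) {x : EuclideanSpace ℝ (Fin n)}
    (hx : x ∈ Ω) : c ≤ liminfExtension Ω E u x := by
  by_cases hxE : x ∈ E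
  · rw [liminfExtension_of_mem hxE]
    exact le_liminf_of_le (by isBoundedDefault) (eventually_mem_nhdsWithin.mono hc)
  · rw [liminfExtension_of_notMem hxE]
    exact hc x ⟨hx, hxE⟩

end Extension

/-! ### Quadratic minorants of the squared distance -/

section Distance

variable {F : Type*} [NormedAddCommGroup F] [InnerProductSpace ℝ F]

theorem norm_sq_eq_starProjection_add (T : Submodule ℝ F) [T.HasOrthogonalProjection] (a : F) :
    ‖a‖ ^ 2 = ‖T.starProjection a‖ ^ 2 + ‖a - T.starProjection a‖ ^ 2 := by
  rw [T.norm_sq_eq_add_norm_sq_starProjection a, T.starProjection_orthogonal_val]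

theorem norm_sub_starProjection_le (T : Submodule ℝ F) [T.HasOrthogonalProjection] {a b : F}
    (hb : b ∈ T) : ‖a - T.starProjection a‖ ≤ ‖a - b‖ := by
  have h := norm_sq_eq_starProjection_add T (a - b)
  rw [map_sub, T.starProjection_eq_self_iff.2 hb, sub_sub_sub_cancel_right] at h
  exact le_of_sq_le_sq (by nlinarith [sq_nonneg ‖T.starProjection a - b‖]) (norm_nonneg _)

/-- Split into components along `T` and orthogonal to it. Flatness makes the normal part of `b`
quadratically small, so the cross term is at most `16 C r` times the squares of the tangential parts
of `a` and `a - b`; the second is absorbed by `‖a - b‖²`. -/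
theorem norm_sq_sub_le_norm_sub_sq_of_flat (T : Submodule ℝ F) [T.HasOrthogonalProjection]
    {a b : F} {C r : ℝ} (hC : 0 ≤ C) (hr : 0 < r) (hCr : 16 * C * r ≤ 1) (ha : ‖a‖ ≤ 2 * r)
    (hb : ‖b‖ ≤ 4 * r) (hflat : ‖b - T.starProjection b‖ ≤ C * ‖b‖ ^ 2) :
    ‖a‖ ^ 2 - (1 + 16 * C * r) * ‖T.starProjection a‖ ^ 2 ≤ ‖a - b‖ ^ 2 := by
  have h₁ := norm_sq_eq_starProjection_add T (a - b)
  have h₂ := norm_sq_eq_starProjection_add T a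
  have h₃ := norm_sq_eq_starProjection_add T b
  rw [map_sub] at h₁
  rw [show a - b - (T.starProjection a - T.starProjection b)
    = (a - T.starProjection a) - (b - T.starProjection b) by abel] at h₁
  have hνw := norm_sub_norm_le (a - T.starProjection a) (b - T.starProjection b)
  have hts := norm_le_norm_add_norm_sub (T.starProjection a) (T.starProjection b)
  set ν := ‖a - T.starProjection a‖
  set w := ‖b - T.starProjection b‖
  set t := ‖T.starProjection a‖
  set s := ‖T.starProjection b‖
  set d := ‖T.starProjection a - T.starProjection b‖
  set e := ‖a - T.starProjection a - (b - T.starProjection b)‖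
  have hν0 : 0 ≤ ν := norm_nonneg _
  have hw0 : 0 ≤ w := norm_nonneg _
  have ht0 : 0 ≤ t := norm_nonneg _
  have hs0 : 0 ≤ s := norm_nonneg _
  have hd0 : 0 ≤ d := norm_nonneg _
  have he0 : 0 ≤ e := norm_nonneg _
  have hν : ν ≤ 2 * r := by
    refine le_trans (le_of_sq_le_sq ?_ (norm_nonneg a)) ha
    nlinarith
  have hw : w ≤ 4 * r := by
    refine le_trans (le_of_sq_le_sq ?_ (norm_nonneg b)) hb
    nlinarith
  -- From `w ≤ C (s² + w²)`, where `C w² ≤ 4 C r w ≤ w / 4` is absorbed on the left.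
  have hw2 : w ≤ 2 * C * s ^ 2 := by
    have : C * w ^ 2 ≤ w / 4 := by
      nlinarith [mul_le_mul_of_nonneg_left hw (mul_nonneg hC hw0),
        mul_le_mul_of_nonneg_right hCr hw0]
    rw [h₃] at hflat
    nlinarith
  have hs2 : s ^ 2 ≤ 2 * t ^ 2 + 2 * d ^ 2 := by
    nlinarith [sq_nonneg (t - d)]
  have he : ν ^ 2 - 2 * ν * w ≤ e ^ 2 := by
    rcases le_total w ν with h | h
    · nlinarith
    · nlinarith [mul_le_mul_of_nonneg_left h hν0]
  have h₄ : 2 * ν * w ≤ 16 * C * r * (t ^ 2 + d ^ 2) := by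
    calc 2 * ν * w ≤ 2 * (2 * r) * (2 * C * s ^ 2) := by gcongr
      _ = 8 * C * r * s ^ 2 := by ring
      _ ≤ 8 * C * r * (2 * t ^ 2 + 2 * d ^ 2) := by gcongr
      _ = _ := by ring
  have h₅ : 16 * C * r * d ^ 2 ≤ 1 * d ^ 2 := by gcongr
  nlinarith

/-- Apply the flat estimate with `a = z - y` and `b = y' - y`, where `y'` is a point of `E` nearest
to `z`. If `z` is within `r = dist x y` of `x`, then `‖a‖ ≤ 2r` and `‖b‖ ≤ 2‖a‖ ≤ 4r`. There is
equality at `z = x` when `y` is nearest to `x` and `x - y` is orthogonal to `T`. -/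
theorem eventually_norm_sq_sub_le_infDist_sq {E : Set F} (hE : IsCompact E) {p x y : F}
    (hp : p ∈ E) (hy : y ∈ E) (hxy : x ≠ y) (T : Submodule ℝ F) [T.HasOrthogonalProjection]
    {C R : ℝ} (hC : 0 ≤ C) (hCr : 16 * C * dist x y ≤ 1) (hxp : dist x p < R / 2)
    (hflat : ∀ y' ∈ E, dist y' p < R →
      ‖(y' - y) - T.starProjection (y' - y)‖ ≤ C * ‖y' - y‖ ^ 2) :
    ∀ᶠ z in 𝓝 x, ‖z - y‖ ^ 2 - (1 + 16 * C * dist x y) * ‖T.starProjection (z - y)‖ ^ 2 ≤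
      Metric.infDist z E ^ 2 := by
  have hr : 0 < dist x y := dist_pos.2 hxy
  filter_upwards [Metric.ball_mem_nhds x hr, Metric.isOpen_ball.mem_nhds hxp] with z hz hzp
  have hzp' : dist z p < R / 2 := hzp
  have hzx : dist z x < dist x y := hz
  obtain ⟨y', hy', hzy'⟩ := hE.exists_infDist_eq_dist ⟨p, hp⟩ z
  have h₁ : dist z y' ≤ dist z p := hzy' ▸ Metric.infDist_le_dist_of_mem hp
  have h₂ : dist z y' ≤ dist z y := hzy' ▸ Metric.infDist_le_dist_of_mem hy
  have h₃ := dist_triangle z x y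
  have h₄ := dist_triangle_left y' p z
  have h₅ := dist_triangle_left y' y z
  rw [hzy', dist_eq_norm z y', ← sub_sub_sub_cancel_right z y' y]
  refine norm_sq_sub_le_norm_sub_sq_of_flat T hC hr hCr ?_ ?_ (hflat y' hy' (by linarith))
  · rw [← dist_eq_norm]; linarith
  · rw [← dist_eq_norm]; linarith

end Distance

/-! ### Tangent spaces of the submanifold -/

/-- A compact submanifold deviates at most quadratically from its tangent spaces, locally
uniformly, and segments to nearest points are orthogonal to the tangent spaces. -/
theorem IsSmoothClosedSubmanifold.exists_tangent {n k : ℕ} {E : Set (EuclideanSpace ℝ (Fin n))}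
    (hE : IsSmoothClosedSubmanifold k E) {p : EuclideanSpace ℝ (Fin n)} (hp : p ∈ E) :
    ∃ C R : ℝ, 0 ≤ C ∧ 0 < R ∧ ∀ y ∈ E, dist y p < R →
      ∃ T : Submodule ℝ (EuclideanSpace ℝ (Fin n)), Module.finrank ℝ T ≤ k ∧
        (∀ y' ∈ E, dist y' p < R →
          ‖(y' - y) - T.starProjection (y' - y)‖ ≤ C * ‖y' - y‖ ^ 2) ∧
        ∀ x, (∀ y' ∈ E, dist x y ≤ dist x y') → T.starProjection (x - y) = 0 := by
  obtain ⟨Φ, hpΦ, hΦ, hΨ, hEΦ⟩ := hE.exists_slice_chart p hp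
  let S : Submodule ℝ (EuclideanSpace ℝ (Fin n)) :=
    { carrier := {v | ∀ i : Fin n, k ≤ (i : ℕ) → v i = 0}
      add_mem' := fun {a b} ha hb i hi => by simp [ha i hi, hb i hi]
      zero_mem' := fun i _ => by simp
      smul_mem' := fun c a ha i hi => by simp [ha i hi] }
  have hS : Module.finrank ℝ S ≤ k := by
    let g : S →ₗ[ℝ] (Fin k → ℝ) :=
      { toFun := fun v j => if h : (j : ℕ) < n then v.1 ⟨j, h⟩ else 0
        map_add' := fun a b => by
          ext j
          by_cases h : (j : ℕ) < n <;> simp [h]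
        map_smul' := fun c a => by
          ext j
          by_cases h : (j : ℕ) < n <;> simp [h] }
    have hg : Function.Injective g := by
      intro a b hab
      ext i
      by_cases hi : (i : ℕ) < k
      · simpa [g] using congrFun hab ⟨i, hi⟩
      · rw [a.2 i (not_lt.1 hi), b.2 i (not_lt.1 hi)]
    simpa using LinearMap.finrank_le_finrank_of_injective hg
  have hΦp : Φ p ∈ Φ.target := Φ.map_source hpΦ
  have hΨat : ∀ η ∈ Φ.target, ContDiffAt ℝ 2 Φ.symm η := fun η hη =>
    mod_cast contDiffAt_infty.1 (hΨ.contDiffAt (Φ.open_target.mem_nhds hη)) 2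
  have hΦat : ContDiffAt ℝ 1 Φ p :=
    mod_cast contDiffAt_infty.1 (hΦ.contDiffAt (Φ.open_source.mem_nhds hpΦ)) 1
  obtain ⟨K, t, ht, hK⟩ :=
    ((hΨat _ hΦp).fderiv_right (m := 1) (by norm_num)).exists_lipschitzOnWith
  obtain ⟨K', s, hs, hK'⟩ := hΦat.exists_lipschitzOnWith
  obtain ⟨δ, hδ, hδt⟩ := Metric.mem_nhds_iff.1 (inter_mem ht (Φ.open_target.mem_nhds hΦp))
  obtain ⟨R, hR, hRs⟩ := Metric.mem_nhds_iff.1 (inter_mem (inter_mem hs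
    (Φ.open_source.mem_nhds hpΦ)) (hΦat.continuousAt.preimage_mem_nhds
      (Metric.ball_mem_nhds (Φ p) hδ)))
  -- `K` is a Lipschitz constant of the derivative of the inverse chart, `K'` one of the chart.
  refine ⟨K * K' ^ 2, R, by positivity, hR, fun y hy hyp => ?_⟩
  have hyR := hRs (Metric.mem_ball.2 hyp)
  have hηt : Φ y ∈ Φ.target := Φ.map_source hyR.1.2
  let D := fderiv ℝ Φ.symm (Φ y)
  refine ⟨S.map (D : EuclideanSpace ℝ (Fin n) →ₗ[ℝ] EuclideanSpace ℝ (Fin n)),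
    (Submodule.finrank_map_le _ _).trans hS, fun y' hy' hyp' => ?_, fun x hx => ?_⟩
  · have hyR' := hRs (Metric.mem_ball.2 hyp')
    have hmem : Φ y' - Φ y ∈ S := S.sub_mem ((hEΦ y' hyR'.1.2).1 hy') ((hEΦ y hyR.1.2).1 hy)
    refine (norm_sub_starProjection_le _ (Submodule.mem_map_of_mem hmem)).trans ?_
    -- On this convex set the derivative of the inverse chart differs from `D` by at most `K ‖Φ y' -
    -- Φ y‖`, so the mean value inequality gives a quadratic remainder.
    have hconv : Convex ℝ (Metric.ball (Φ p) δ ∩ Metric.closedBall (Φ y) ‖Φ y' - Φ y‖) :=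
      (convex_ball _ _).inter (convex_closedBall _ _)
    have h := hconv.norm_image_sub_le_of_norm_hasFDerivWithin_le' (f := Φ.symm)
      (f' := fderiv ℝ Φ.symm) (φ := D) (C := K * ‖Φ y' - Φ y‖) (x := Φ y) (y := Φ y')
      (fun ξ hξ => ((hΨat ξ (hδt hξ.1).2).differentiableAt
        (by norm_num)).hasFDerivAt.hasFDerivWithinAt) (fun ξ hξ => by
        rw [← dist_eq_norm]
        refine (hK.dist_le_mul _ (hδt hξ.1).1 _ (hδt hyR.2).1).trans ?_
        gcongr
        exact hξ.2) ⟨hyR.2, Metric.mem_closedBall_self (norm_nonneg _)⟩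
        ⟨hyR'.2, by rw [Metric.mem_closedBall, dist_eq_norm]⟩
    rw [Φ.left_inv hyR.1.2, Φ.left_inv hyR'.1.2] at h
    refine h.trans ?_
    have hlip := hK'.dist_le_mul _ hyR'.1.1 _ hyR.1.1
    rw [dist_eq_norm, dist_eq_norm] at hlip
    calc K * ‖Φ y' - Φ y‖ * ‖Φ y' - Φ y‖ = K * ‖Φ y' - Φ y‖ ^ 2 := by ring
      _ ≤ K * (K' * ‖y' - y‖) ^ 2 := by gcongr
      _ = K * K' ^ 2 * ‖y' - y‖ ^ 2 := by ring
  · rw [Submodule.starProjection_apply_eq_zero_iff, Submodule.mem_orthogonal]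
    rintro _ ⟨τ, hτ, rfl⟩
    -- The inverse chart maps this line, near `Φ y`, to a curve in `E` with velocity `D τ` at `y`;
    -- minimality of the distance gives orthogonality.
    let c : ℝ → EuclideanSpace ℝ (Fin n) := fun s => Φ y + s • τ
    have hc : HasDerivAt c τ 0 := by
      have := ((hasDerivAt_id (0 : ℝ)).smul_const τ).const_add (Φ y)
      rwa [one_smul] at this
    have hc0 : c 0 = Φ y := by simp [c]
    have hΨc : HasDerivAt (fun s => Φ.symm (c s)) (D τ) 0 := by
      refine HasFDerivAt.comp_hasDerivAt (0 : ℝ) ?_ hc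
      rw [hc0]
      exact ((hΨat _ hηt).differentiableAt (by norm_num)).hasFDerivAt
    have hd : HasDerivAt (fun s => ‖x - Φ.symm (c s)‖ ^ 2) (2 * inner ℝ (x - y) (-(D τ))) 0 := by
      have := (hΨc.const_sub x).norm_sq
      rwa [hc0, Φ.left_inv hyR.1.2] at this
    have hmin : IsLocalMin (fun s => ‖x - Φ.symm (c s)‖ ^ 2) 0 := by
      have hct : ∀ᶠ s in 𝓝 (0 : ℝ), c s ∈ Φ.target :=
        hc.continuousAt.eventually_mem (by rw [hc0]; exact Φ.open_target.mem_nhds hηt)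
      filter_upwards [hct] with s hs
      have hmem : Φ.symm (c s) ∈ E := by
        rw [hEΦ _ (Φ.map_target hs), Φ.right_inv hs]
        exact S.add_mem ((hEΦ y hyR.1.2).1 hy) (S.smul_mem s hτ)
      have := hx _ hmem
      rw [dist_eq_norm, dist_eq_norm] at this
      rw [hc0, Φ.left_inv hyR.1.2]
      gcongr
    have h0 := hmin.hasDerivAt_eq_zero hd
    rw [inner_neg_right, real_inner_comm] at h0
    change inner ℝ (D τ) (x - y) = 0
    linarith

/-! ### Second derivatives and the logarithmic barrier -/

section SecondDerivative

variable {F : Type*} [NormedAddCommGroup F]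

theorem fderiv_fderiv_comp_apply [NormedSpace ℝ F] {f f' : ℝ → ℝ} {f'' : ℝ} {Q : F → ℝ}
    {L : F → F →L[ℝ] ℝ} {L' : F →L[ℝ] F →L[ℝ] ℝ} {x : F}
    (hf : ∀ᶠ q in 𝓝 (Q x), HasDerivAt f (f' q) q) (hf' : HasDerivAt f' f'' (Q x))
    (hQ : ∀ z, HasFDerivAt Q (L z) z) (hL : HasFDerivAt L L' x) (v : F) :
    fderiv ℝ (fderiv ℝ fun z => f (Q z)) x v v = f' (Q x) * L' v v + f'' * L x v ^ 2 := by
  have h₁ : fderiv ℝ (fun z => f (Q z)) =ᶠ[𝓝 x] fun z => f' (Q z) • L z := by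
    filter_upwards [(hQ x).continuousAt.eventually hf] with z hz
    exact (hz.comp_hasFDerivAt z (hQ z)).fderiv
  have h₂ : HasFDerivAt (fun z => f' (Q z) • L z)
      (f' (Q x) • L' + (f'' • L x).smulRight (L x)) x :=
    (hf'.comp_hasFDerivAt x (hQ x)).smul hL
  rw [h₁.fderiv_eq, h₂.fderiv]
  simp only [add_apply, smul_apply, smul_eq_mul,
    ContinuousLinearMap.smulRight_apply]
  ring

theorem fderiv_fderiv_add_apply [NormedSpace ℝ F] {f g : F → ℝ} {x : F} (hf : ContDiffAt ℝ 2 f x)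
    (hg : ContDiffAt ℝ 2 g x) (v w : F) :
    fderiv ℝ (fderiv ℝ fun z => f z + g z) x v w =
      fderiv ℝ (fderiv ℝ f) x v w + fderiv ℝ (fderiv ℝ g) x v w := by
  have h : fderiv ℝ (fun z => f z + g z) =ᶠ[𝓝 x] fun z => fderiv ℝ f z + fderiv ℝ g z := by
    filter_upwards [hf.eventually (by simp), hg.eventually (by simp)] with z h₁ h₂
    exact fderiv_fun_add (h₁.differentiableAt (by norm_num)) (h₂.differentiableAt (by norm_num))
  rw [h.fderiv_eq, fderiv_fun_add
    ((hf.fderiv_right (m := 1) (by norm_num)).differentiableAt (by norm_num))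
    ((hg.fderiv_right (m := 1) (by norm_num)).differentiableAt (by norm_num))]
  rfl

variable [InnerProductSpace ℝ F]

/-- The polarization of `w ↦ 2 (‖w‖² - a ‖P w‖²)`, `P` the orthogonal projection onto `T`. -/
noncomputable def innerSubProjection (T : Submodule ℝ F) [T.HasOrthogonalProjection] (a : ℝ) :
    F →L[ℝ] F →L[ℝ] ℝ :=
  let B : F →L[ℝ] F →L[ℝ] ℝ := innerSL ℝ
  (2 : ℝ) • B - (2 * a) • B.comp T.starProjection

theorem innerSubProjection_apply (T : Submodule ℝ F) [T.HasOrthogonalProjection] (a : ℝ) (w v : F) :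
    innerSubProjection T a w v = 2 * inner ℝ w v - 2 * a * inner ℝ (T.starProjection w) v := rfl

theorem hasFDerivAt_norm_sq_sub_starProjection (T : Submodule ℝ F) [T.HasOrthogonalProjection]
    (a : ℝ) (y z : F) :
    HasFDerivAt (fun z => ‖z - y‖ ^ 2 - a * ‖T.starProjection (z - y)‖ ^ 2)
      (innerSubProjection T a (z - y)) z := by
  have h₁ : HasFDerivAt (fun z => z - y) (ContinuousLinearMap.id ℝ F) z :=
    (hasFDerivAt_id z).sub_const y
  have h₂ : HasFDerivAt (fun z => T.starProjection (z - y)) T.starProjection z :=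
    T.starProjection.hasFDerivAt.comp z h₁
  refine (h₁.norm_sq.sub (h₂.norm_sq.const_mul a)).congr_fderiv ?_
  ext v
  have h₃ : inner ℝ (T.starProjection (z - y)) (T.starProjection v) =
      inner ℝ (T.starProjection (z - y)) v := by
    rw [← T.inner_starProjection_left_eq_right,
      T.starProjection_eq_self_iff.2 (T.starProjection_apply_mem _)]
  simp only [innerSubProjection_apply, sub_apply, smul_apply,
    ContinuousLinearMap.comp_apply, innerSL_apply_apply, smul_eq_mul, nsmul_eq_mul,
    ContinuousLinearMap.id_apply, h₃, Nat.cast_ofNat]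
  ring

/-- Expand in an orthonormal basis of `T`, exchange the sums and apply Bessel's inequality to each
basis vector. -/
theorem sum_norm_sq_starProjection_le {ι : Type*} [Fintype ι] {v : ι → F} (hv : Orthonormal ℝ v)
    (T : Submodule ℝ F) [FiniteDimensional ℝ T] :
    ∑ i, ‖T.starProjection (v i)‖ ^ 2 ≤ Module.finrank ℝ T := by
  let b := stdOrthonormalBasis ℝ T
  have h : ∀ i, ‖T.starProjection (v i)‖ ^ 2 = ∑ j, ‖inner ℝ (v i) (b j : F)‖ ^ 2 := by
    intro i
    rw [T.starProjection_apply, ← Submodule.coe_norm, ← b.sum_sq_norm_inner_left]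
    simp
  simp_rw [h]
  rw [Finset.sum_comm]
  calc ∑ j, ∑ i, ‖inner ℝ (v i) (b j : F)‖ ^ 2 ≤ ∑ j, ‖(b j : F)‖ ^ 2 :=
        Finset.sum_le_sum fun j _ => hv.sum_inner_products_le _
    _ = Module.finrank ℝ T := by
        simp [← Submodule.coe_norm]

/-- The radial profile of the barrier, as a function of the squared distance. -/
noncomputable def logBarrier (A q : ℝ) : ℝ := Real.log q + A * √q

theorem hasDerivAt_logBarrier (A : ℝ) {q : ℝ} (hq : 0 < q) :
    HasDerivAt (logBarrier A) (q⁻¹ + A * (1 / (2 * √q))) q :=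
  (Real.hasDerivAt_log hq.ne').add ((Real.hasDerivAt_sqrt hq.ne').const_mul A)

theorem hasDerivAt_deriv_logBarrier (A : ℝ) {r : ℝ} (hr : 0 < r) :
    HasDerivAt (fun q => q⁻¹ + A * (1 / (2 * √q))) (-(1 / r ^ 4) - A / (4 * r ^ 3)) (r ^ 2) := by
  have hq : r ^ 2 ≠ 0 := by positivity
  have hs : √(r ^ 2) = r := Real.sqrt_sq hr.le
  have h₁ := (((Real.hasDerivAt_sqrt hq).const_mul 2).fun_inv
    (by rw [hs]; positivity)).const_mul A
  refine ((hasDerivAt_inv hq).add h₁).congr_deriv ?_ |>.congr_of_eventuallyEq ?_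
  · rw [hs]
    field_simp
    ring
  · exact Eventually.of_forall fun q => by simp

theorem contDiffAt_logBarrier (A : ℝ) {q : ℝ} (hq : 0 < q) : ContDiffAt ℝ 2 (logBarrier A) q :=
  (Real.contDiffAt_log.2 hq.ne').add (contDiffAt_const.mul (Real.contDiffAt_sqrt hq.ne'))

theorem logBarrier_mono {A : ℝ} (hA : 0 ≤ A) {p q : ℝ} (hp : 0 < p) (hpq : p ≤ q) :
    logBarrier A p ≤ logBarrier A q := by
  unfold logBarrier
  gcongr

theorem logBarrier_le {A : ℝ} (hA : 0 ≤ A) {q : ℝ} (hq : 0 < q) (hq1 : q ≤ 1) :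
    logBarrier A q ≤ A := by
  simpa [logBarrier] using logBarrier_mono hA hq hq1

theorem tendsto_logBarrier_sq (A : ℝ) :
    Tendsto (fun d => logBarrier A (d ^ 2)) (𝓝[>] 0) atBot := by
  have h : Tendsto (fun d : ℝ => d ^ 2) (𝓝[>] 0) (𝓝[>] 0) := by
    refine tendsto_nhdsWithin_iff.2 ⟨?_, ?_⟩
    · exact ((continuous_pow 2).tendsto' (0 : ℝ) 0 (by simp)).mono_left nhdsWithin_le_nhds
    · filter_upwards [self_mem_nhdsWithin] with d hd using pow_pos (mem_Ioi.1 hd) 2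
  refine Tendsto.comp (g := logBarrier A) ?_ h
  refine Real.tendsto_log_nhdsGT_zero.atBot_add (C := 0) ?_
  exact (Continuous.tendsto' (by fun_prop) 0 0 (by simp)).mono_left nhdsWithin_le_nhds

/-- The barrier has positive trace on every `(k + 2)`-dimensional subspace. -/
theorem sum_fderiv_fderiv_logBarrier_pos {k : ℕ} {v : Fin (k + 2) → F} (hv : Orthonormal ℝ v)
    (T : Submodule ℝ F) [FiniteDimensional ℝ T] (hT : Module.finrank ℝ T ≤ k) {K A : ℝ}
    (hK : 0 ≤ K) (hA : A = 2 * (K * k) + 1) {x y : F} (hxy : x ≠ y)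
    (hperp : T.starProjection (x - y) = 0) (hr : K * k * A * dist x y < 1) :
    0 < ∑ i, fderiv ℝ (fderiv ℝ fun z => logBarrier A (‖z - y‖ ^ 2 -
      (1 + K * dist x y) * ‖T.starProjection (z - y)‖ ^ 2)) x (v i) (v i) := by
  have hr0 : 0 < dist x y := dist_pos.2 hxy
  have hnorm : ‖x - y‖ = dist x y := (dist_eq_norm x y).symm
  set r := dist x y
  let Λ : F →L[ℝ] F →L[ℝ] ℝ := innerSubProjection T (1 + K * r)
  have hQx : ‖x - y‖ ^ 2 - (1 + K * r) * ‖T.starProjection (x - y)‖ ^ 2 = r ^ 2 := by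
    rw [hperp, hnorm]
    simp
  have hΛ : ∀ w, Λ w w = 2 * ‖w‖ ^ 2 - 2 * (1 + K * r) * ‖T.starProjection w‖ ^ 2 := by
    intro w
    have : inner ℝ (T.starProjection w) w = ‖T.starProjection w‖ ^ 2 := by
      rw [← real_inner_self_eq_norm_sq, ← T.inner_starProjection_left_eq_right,
        T.starProjection_eq_self_iff.2 (T.starProjection_apply_mem _)]
    rw [innerSubProjection_apply, this, real_inner_self_eq_norm_sq]
  have hΛx : ∀ w, Λ (x - y) w = 2 * inner ℝ w (x - y) := by
    intro w
    rw [innerSubProjection_apply, hperp, inner_zero_left, mul_zero, sub_zero, real_inner_comm]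
  have key : ∀ w, fderiv ℝ (fderiv ℝ fun z => logBarrier A (‖z - y‖ ^ 2 -
      (1 + K * r) * ‖T.starProjection (z - y)‖ ^ 2)) x w w =
      (1 / r ^ 2 + A / (2 * r)) *
        (2 * ‖w‖ ^ 2 - 2 * (1 + K * r) * ‖T.starProjection w‖ ^ 2) +
      (-(1 / r ^ 4) - A / (4 * r ^ 3)) * (4 * ‖inner ℝ w (x - y)‖ ^ 2) := by
    intro w
    rw [fderiv_fderiv_comp_apply (L := fun z => Λ (z - y)) (L' := Λ)
      (f' := fun q => q⁻¹ + A * (1 / (2 * √q))) (f'' := -(1 / r ^ 4) - A / (4 * r ^ 3)) ?_ ?_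
      (fun z => hasFDerivAt_norm_sq_sub_starProjection T _ y z) ?_ w]
    · rw [hQx, hΛ, hΛx, Real.sqrt_sq hr0.le, Real.norm_eq_abs, sq_abs]
      ring
    · rw [hQx]
      filter_upwards [lt_mem_nhds (show 0 < r ^ 2 by positivity)] with q hq
      exact hasDerivAt_logBarrier A hq
    · rw [hQx]
      exact hasDerivAt_deriv_logBarrier A hr0
    · exact Λ.hasFDerivAt.comp x ((hasFDerivAt_id x).sub_const y)
  simp_rw [key, hv.norm_eq_one]
  have h₁ : ∑ i, ‖T.starProjection (v i)‖ ^ 2 ≤ k :=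
    (sum_norm_sq_starProjection_le hv T).trans (mod_cast hT)
  have h₂ : ∑ i, ‖inner ℝ (v i) (x - y)‖ ^ 2 ≤ r ^ 2 := by
    rw [← hnorm]
    exact hv.sum_inner_products_le _
  rw [Finset.sum_add_distrib, ← Finset.mul_sum, ← Finset.mul_sum, ← Finset.mul_sum,
    Finset.sum_sub_distrib, ← Finset.mul_sum (f := fun i => ‖T.starProjection (v i)‖ ^ 2)]
  set S₁ := ∑ i, ‖T.starProjection (v i)‖ ^ 2
  set S₂ := ∑ i, ‖inner ℝ (v i) (x - y)‖ ^ 2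
  have hk : (0 : ℝ) ≤ k := Nat.cast_nonneg k
  have hA0 : 0 ≤ A := by rw [hA]; positivity
  have h₃ : 4 - 2 * K * k * r ≤
      ∑ i : Fin (k + 2), 2 * (1 : ℝ) ^ 2 - 2 * (1 + K * r) * S₁ := by
    have : 2 * (1 + K * r) * S₁ ≤ 2 * (1 + K * r) * k := by gcongr
    simp
    linarith
  have h₄ : (1 / r ^ 2 + A / (2 * r)) * (4 - 2 * K * k * r) ≤ (1 / r ^ 2 + A / (2 * r)) *
      (∑ i : Fin (k + 2), 2 * (1 : ℝ) ^ 2 - 2 * (1 + K * r) * S₁) := by gcongr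
  have h₅ : (1 / r ^ 4 + A / (4 * r ^ 3)) * (4 * S₂) ≤
      (1 / r ^ 4 + A / (4 * r ^ 3)) * (4 * r ^ 2) := by gcongr
  -- The `1/r²` terms cancel, as for the planar logarithm. The `1/r` terms have coefficient `A - 2 K
  -- k`, which the choice of `A` makes `1`.
  have h₆ : (1 / r ^ 2 + A / (2 * r)) * (4 - 2 * K * k * r) -
      (1 / r ^ 4 + A / (4 * r ^ 3)) * (4 * r ^ 2) = (1 - K * k * A * r) / r := by
    rw [hA]
    field_simp
    ring
  have h₇ : 0 < (1 - K * k * A * r) / r := div_pos (by linarith) hr0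
  linarith

end SecondDerivative

/-! ### Moving the contact point off the submanifold -/

/-- Perturbing a test function that touches the liminf extension at a point of `E` by a small
multiple of the logarithmic barrier moves the contact point off `E`. -/
theorem exists_touching_logBarrier {n : ℕ} {Ω E : Set (EuclideanSpace ℝ (Fin n))}
    {u : EuclideanSpace ℝ (Fin n) → EReal} (hE : IsClosed E)
    (hu : LowerSemicontinuousOn u (Ω \ E)) {φ : EuclideanSpace ℝ (Fin n) → ℝ}
    {x₀ : EuclideanSpace ℝ (Fin n)} (hx₀ : x₀ ∈ E) {R c A : ℝ} (hR : 0 < R) (hR1 : R ≤ 1)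
    (hc : 0 < c) (hA : 0 ≤ A) (hRΩ : Metric.closedBall x₀ R ⊆ Ω)
    (hφ : ContinuousOn φ (Metric.closedBall x₀ R)) (hle : ∀ x ∈ Ω \ E, (φ x : EReal) ≤ u x)
    (heq : liminf u (𝓝[Ω \ E] x₀) = φ x₀) :
    ∃ ε m : ℝ, 0 < ε ∧ ∃ x ∈ Metric.ball x₀ R \ E,
      (((φ x - c * ‖x - x₀‖ ^ 2 + ε * logBarrier A (Metric.infDist x E ^ 2) + m : ℝ)) : EReal)
        = u x ∧
      ∀ z ∈ Metric.ball x₀ R \ E,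
        (((φ z - c * ‖z - x₀‖ ^ 2 + ε * logBarrier A (Metric.infDist z E ^ 2) + m : ℝ)) : EReal)
          ≤ u z := by
  have hpos : ∀ z, z ∉ E → 0 < Metric.infDist z E := fun z hz =>
    (hE.notMem_iff_infDist_pos ⟨x₀, hx₀⟩).1 hz
  have hdle : ∀ z, Metric.infDist z E ≤ dist z x₀ := fun z => Metric.infDist_le_dist_of_mem hx₀
  have hbar : ∀ z ∈ Metric.closedBall x₀ R \ E, logBarrier A (Metric.infDist z E ^ 2) ≤ A := by
    intro z hz
    have hzR : dist z x₀ ≤ R := hz.1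
    exact logBarrier_le hA (pow_pos (hpos z hz.2) 2)
      (pow_le_one₀ Metric.infDist_nonneg ((hdle z).trans (hzR.trans hR1)))
  -- The liminf is only approached, so a nearby point off `E` serves as competitor, with total error
  -- below `c R² / 2`.
  obtain ⟨x₁, hx₁φ, hx₁, hx₁u⟩ : ∃ x₁, φ x₀ - c * R ^ 2 / 4 < φ x₁ - c * ‖x₁ - x₀‖ ^ 2 ∧
      x₁ ∈ Metric.ball x₀ R \ E ∧ u x₁ < ((φ x₀ + c * R ^ 2 / 4 : ℝ) : EReal) := by
    have hcR : 0 < c * R ^ 2 / 4 := by positivity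
    have hfreq := frequently_lt_of_liminf_lt (f := 𝓝[Ω \ E] x₀) (u := u)
      (b := ((φ x₀ + c * R ^ 2 / 4 : ℝ) : EReal))
      (h := by rw [heq]; exact EReal.coe_lt_coe_iff.2 (by linarith))
    have hcont : ContinuousAt (fun x => φ x - c * ‖x - x₀‖ ^ 2) x₀ :=
      (hφ.continuousAt (Metric.closedBall_mem_nhds x₀ hR)).sub (by fun_prop)
    have hev : ∀ᶠ x in 𝓝 x₀, φ x₀ - c * R ^ 2 / 4 < φ x - c * ‖x - x₀‖ ^ 2 :=
      hcont.eventually (lt_mem_nhds (by simpa using hcR))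
    have hev' : ∀ᶠ x in 𝓝 x₀, x ∈ Metric.ball x₀ R := Metric.ball_mem_nhds x₀ hR
    obtain ⟨x₁, h₁, ⟨h₂, h₃⟩, h₄⟩ := (hfreq.and_eventually
      (((hev.and hev').filter_mono nhdsWithin_le_nhds).and eventually_mem_nhdsWithin)).exists
    exact ⟨x₁, h₂, ⟨h₃, h₄.2⟩, h₁⟩
  -- This `ε` spends the other half of `c R²`, so that `w x₁ < c R² - ε A`, a lower bound for `w` on
  -- the sphere of radius `R`.
  obtain ⟨ε, hε, hεlt⟩ := exists_pos_mul_lt (show 0 < c * R ^ 2 / 2 by positivity)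
    (A - logBarrier A (Metric.infDist x₁ E ^ 2))
  rw [mul_sub_right_distrib] at hεlt
  let b : EuclideanSpace ℝ (Fin n) → ℝ := fun z =>
    -(φ z - c * ‖z - x₀‖ ^ 2 + ε * logBarrier A (Metric.infDist z E ^ 2))
  let w : EuclideanSpace ℝ (Fin n) → EReal := fun z => u z + (b z : EReal)
  have hlow : ∀ z ∈ Metric.closedBall x₀ R \ E,
      ((c * ‖z - x₀‖ ^ 2 - ε * logBarrier A (Metric.infDist z E ^ 2) : ℝ) : EReal) ≤ w z := by
    intro z hz
    refine le_trans (le_of_eq ?_) (add_le_add_left (hle z ⟨hRΩ hz.1, hz.2⟩) (b z : EReal))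
    rw [← EReal.coe_add]
    congr 1
    simp only [b]
    ring
  have hw₁ : w x₁ < ((c * R ^ 2 - ε * A : ℝ) : EReal) := by
    refine lt_of_lt_of_le (EReal.add_lt_add_right_coe hx₁u (b x₁)) ?_
    rw [← EReal.coe_add, EReal.coe_le_coe_iff]
    simp only [b]
    linarith
  -- Within distance `η` of `E` the barrier alone lifts `w` to at least `c R²`, so minimizing over
  -- the compact set `S` suffices.
  obtain ⟨η, hη, hηlt⟩ : ∃ η > 0, ∀ d ∈ Ioo 0 η, logBarrier A (d ^ 2) ≤ -(c * R ^ 2 / ε) :=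
    mem_nhdsGT_iff_exists_Ioo_subset.1
      ((tendsto_logBarrier_sq A).eventually (eventually_le_atBot _))
  have hfar : ∀ z ∈ Metric.closedBall x₀ R \ E, Metric.infDist z E < η → w x₁ < w z := by
    intro z hz hzη
    refine hw₁.trans_le (le_trans ?_ (hlow z hz))
    rw [EReal.coe_le_coe_iff]
    have h₁ := mul_le_mul_of_nonneg_left (hηlt _ ⟨hpos z hz.2, hzη⟩) hε.le
    rw [mul_neg, mul_div_cancel₀ _ hε.ne'] at h₁
    have h₂ : 0 ≤ c * ‖z - x₀‖ ^ 2 := by positivity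
    have h₃ : 0 ≤ ε * A := by positivity
    linarith
  let S := Metric.closedBall x₀ R ∩ {z | η ≤ Metric.infDist z E}
  have hSc : IsCompact S := (isCompact_closedBall x₀ R).inter_right
    (isClosed_le continuous_const (Metric.continuous_infDist_pt E))
  have hSE : S ⊆ Metric.closedBall x₀ R \ E := by
    refine fun z hz => ⟨hz.1, fun hzE => ?_⟩
    have : η ≤ Metric.infDist z E := hz.2
    rw [Metric.infDist_zero_of_mem hzE] at this
    exact absurd this (not_le.2 hη)
  have hx₁S : x₁ ∈ S := by
    refine ⟨Metric.ball_subset_closedBall hx₁.1, ?_⟩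
    by_contra h
    exact lt_irrefl _ (hfar x₁ ⟨Metric.ball_subset_closedBall hx₁.1, hx₁.2⟩ (not_le.1 h))
  have hb : ContinuousOn b S := by
    have h₁ : ContinuousOn (fun z => logBarrier A (Metric.infDist z E ^ 2)) S := by
      intro z hz
      have : ContinuousAt (logBarrier A) (Metric.infDist z E ^ 2) :=
        (hasDerivAt_logBarrier A (pow_pos (hpos z (hSE hz).2) 2)).continuousAt
      exact (ContinuousAt.comp (f := fun z => Metric.infDist z E ^ 2) this
        ((Metric.continuous_infDist_pt E).pow 2).continuousAt).continuousWithinAt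
    exact (((hφ.mono inter_subset_left).sub (by fun_prop)).add (h₁.const_smul ε)).neg
  have hw : LowerSemicontinuousOn w S := by
    refine (hu.mono fun z hz => ⟨hRΩ hz.1, (hSE hz).2⟩).add'
      (continuous_coe_real_ereal.comp_continuousOn hb).lowerSemicontinuousOn fun z _ => ?_
    exact EReal.continuousAt_add (Or.inr (EReal.coe_ne_bot _)) (Or.inr (EReal.coe_ne_top _))
  obtain ⟨x, hxS, hxmin⟩ := hw.exists_isMinOn ⟨x₁, hx₁S⟩ hSc
  have hx₁x : w x ≤ w x₁ := hxmin hx₁S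
  have hxE := hSE hxS
  have hmin : ∀ z ∈ Metric.closedBall x₀ R \ E, w x ≤ w z := by
    intro z hz
    by_cases hzη : η ≤ Metric.infDist z E
    · exact hxmin (show z ∈ S from ⟨hz.1, hzη⟩)
    · exact hx₁x.trans (hfar z hz (not_le.1 hzη)).le
  have hxball : x ∈ Metric.ball x₀ R := by
    by_contra h
    have h₁ : dist x x₀ = R := le_antisymm hxE.1 (not_lt.1 h)
    have h₂ := (hlow x hxE).trans_lt (hx₁x.trans_lt hw₁)
    rw [EReal.coe_lt_coe_iff, ← dist_eq_norm, h₁] at h₂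
    have := mul_le_mul_of_nonneg_left (hbar x hxE) hε.le
    linarith
  have hux : ∃ μ : ℝ, u x = μ := by
    have h := hle x ⟨hRΩ hxE.1, hxE.2⟩
    have h' : w x < ⊤ := (hx₁x.trans_lt hw₁).trans (EReal.coe_lt_top _)
    simp only [w] at h'
    induction hux : u x with
    | bot => simp [hux] at h
    | coe a => exact ⟨a, rfl⟩
    | top => simp [hux] at h'
  obtain ⟨μ, hμ⟩ := hux
  refine ⟨ε, μ + b x, hε, x, ⟨hxball, hxE.2⟩, ?_, fun z hz => ?_⟩
  · rw [hμ, EReal.coe_eq_coe_iff]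
    simp only [b]
    ring
  · have hz' : z ∈ Metric.closedBall x₀ R \ E := ⟨Metric.ball_subset_closedBall hz.1, hz.2⟩
    have h := hle z ⟨hRΩ hz'.1, hz.2⟩
    have h' := hmin z hz'
    simp only [w, hμ] at h'
    induction huz : u z with
    | bot => simp [huz] at h
    | coe a =>
      rw [huz, ← EReal.coe_add, ← EReal.coe_add, EReal.coe_le_coe_iff] at h'
      rw [EReal.coe_le_coe_iff]
      simp only [b] at h' ⊢
      linarith
    | top => exact le_top

/-! ### The contradiction at the contact point -/

theorem fderiv_fderiv_norm_sub_sq {F : Type*} [NormedAddCommGroup F] [InnerProductSpace ℝ F]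
    (x₀ x v : F) (c : ℝ) :
    fderiv ℝ (fderiv ℝ fun z => c * ‖z - x₀‖ ^ 2) x v v = 2 * c * ‖v‖ ^ 2 := by
  have hQ := fun z => hasFDerivAt_norm_sq_sub_starProjection (⊥ : Submodule ℝ F) 0 x₀ z
  simp only [zero_mul, sub_zero] at hQ
  rw [fderiv_fderiv_comp_apply (f := fun q => c * q) (f' := fun _ => c) (f'' := 0)
    (Eventually.of_forall fun q => by simpa using (hasDerivAt_id q).const_mul c)
    (hasDerivAt_const _ _) hQ
    ((innerSubProjection ⊥ 0).hasFDerivAt.comp x ((hasFDerivAt_id x).sub_const x₀)) v]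
  change c * innerSubProjection ⊥ 0 v v + _ = _
  rw [innerSubProjection_apply, real_inner_self_eq_norm_sq]
  ring

theorem fderiv_fderiv_const_mul_apply {F : Type*} [NormedAddCommGroup F] [NormedSpace ℝ F]
    (ε : ℝ) {f : F → ℝ} {x : F} (hf : ContDiffAt ℝ 2 f x) (v w : F) :
    fderiv ℝ (fderiv ℝ fun z => ε * f z) x v w = ε * fderiv ℝ (fderiv ℝ f) x v w := by
  have h : fderiv ℝ (fun z => ε * f z) =ᶠ[𝓝 x] fun z => ε • fderiv ℝ f z := by
    filter_upwards [hf.eventually (by simp)] with z hz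
    exact fderiv_const_mul (hz.differentiableAt (by norm_num)) ε
  rw [h.fderiv_eq, fderiv_fun_const_smul
    ((hf.fderiv_right (m := 1) (by norm_num)).differentiableAt (by norm_num))]
  rfl

/-- Coercivity of a bilinear form depending continuously on a parameter is an open condition. -/
theorem eventually_coercive_of_continuousAt {X F : Type*} [TopologicalSpace X]
    [NormedAddCommGroup F] [NormedSpace ℝ F] {B : X → F →L[ℝ] F →L[ℝ] ℝ} {x₀ : X} {a b : ℝ}
    (hB : ContinuousAt B x₀) (ha : ∀ v, a * ‖v‖ ^ 2 ≤ B x₀ v v) (hba : b < a) :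
    ∀ᶠ z in 𝓝 x₀, ∀ v, b * ‖v‖ ^ 2 ≤ B z v v := by
  filter_upwards [hB.eventually (Metric.ball_mem_nhds (B x₀) (sub_pos.2 hba))] with z hz v
  have hz' : ‖B z - B x₀‖ < a - b := (dist_eq_norm (B z) (B x₀)).symm.trans_lt hz
  have h₁ := (neg_le_abs _).trans ((B z - B x₀).le_opNorm₂ v v)
  have h₂ : ‖B z - B x₀‖ * ‖v‖ * ‖v‖ ≤ (a - b) * ‖v‖ * ‖v‖ := by gcongr
  simp only [sub_apply] at h₁
  nlinarith [ha v]

/-- A strictly convex test function cannot touch the extension at a point of the submanifold. -/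
theorem sumSmallestEigenvalues_one_nonpos_of_touching {n k : ℕ} (hkn : k + 2 ≤ n)
    {Ω E : Set (EuclideanSpace ℝ (Fin n))} (hΩ : IsOpen Ω) (hE : IsSmoothClosedSubmanifold k E)
    {u : EuclideanSpace ℝ (Fin n) → EReal} (hu : IsViscositySuperaffine (k + 2) (Ω \ E) u)
    {φ : EuclideanSpace ℝ (Fin n) → ℝ} (hφ : ContDiffOn ℝ 2 φ Ω)
    (hle : ∀ x ∈ Ω \ E, (φ x : EReal) ≤ u x) {x₀ : EuclideanSpace ℝ (Fin n)} (hx₀ : x₀ ∈ Ω)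
    (hx₀E : x₀ ∈ E) (heq : liminf u (𝓝[Ω \ E] x₀) = φ x₀) :
    sumSmallestEigenvalues 1 (hessianMatrix φ x₀) ≤ 0 := by
  by_contra! hpos
  have hφat : ∀ x ∈ Ω, ContDiffAt ℝ 2 φ x := fun x hx => hφ.contDiffAt (hΩ.mem_nhds hx)
  -- Of the convexity `4c` at `x₀`, `2c` survives nearby by continuity, exactly the Hessian of the
  -- subtracted `c‖x - x₀‖²`.
  obtain ⟨c, hc⟩ : ∃ c, sumSmallestEigenvalues 1 (hessianMatrix φ x₀) = 4 * c :=
    ⟨sumSmallestEigenvalues 1 (hessianMatrix φ x₀) / 4, by ring⟩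
  have hc0 : 0 < c := by linarith
  have hcoer : ∀ v, 4 * c * ‖v‖ ^ 2 ≤ fderiv ℝ (fderiv ℝ φ) x₀ v v := by
    intro v
    have := sumSmallestEigenvalues_one_mul_sq_norm_le
      (hessianMatrix_isHermitian (hφat x₀ hx₀)) v
    rwa [inner_toEuclideanLin_hessianMatrix, hc] at this
  have hcoer' : ∀ᶠ z in 𝓝 x₀, ∀ v, 2 * c * ‖v‖ ^ 2 ≤ fderiv ℝ (fderiv ℝ φ) z v v := by
    have hcont : ContinuousAt (fderiv ℝ (fderiv ℝ φ)) x₀ :=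
      (((hφat x₀ hx₀).fderiv_right (m := 1) (by norm_num)).fderiv_right
        (m := 0) (by norm_num)).continuousAt
    exact eventually_coercive_of_continuousAt hcont hcoer (by linarith)
  obtain ⟨R₁, hR₁, hball⟩ := Metric.eventually_nhds_iff_ball.1
    (hcoer'.and (hΩ.eventually_mem hx₀))
  obtain ⟨C, R₂, hC, hR₂, htan⟩ := hE.exists_tangent hx₀E
  set K := 16 * C with hK
  have hK0 : 0 ≤ K := by positivity
  set A := 2 * (K * k) + 1 with hA
  have hA0 : 0 ≤ A := by positivity
  -- The nearest point `y` to `x` satisfies `dist y x₀ < 2R`, hence `R < R₂ / 2`. The last two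
  -- bounds serve the distance minorant and the barrier's positivity.
  obtain ⟨R, hR, hR1, hRR₁, hRR₂, hKR, hKAR⟩ : ∃ R : ℝ, 0 < R ∧ R < 1 ∧ R < R₁ ∧ R < R₂ / 2 ∧
      K * R < 1 ∧ K * k * A * R < 1 := by
    have hlim : ∀ B : ℝ, ∀ᶠ R in 𝓝[>] (0 : ℝ), B * R < 1 := fun B =>
      (((continuous_const_mul B).tendsto' 0 0 (by simp)).eventually
        (gt_mem_nhds one_pos)).filter_mono nhdsWithin_le_nhds
    have hlt : ∀ B : ℝ, 0 < B → ∀ᶠ R in 𝓝[>] (0 : ℝ), R < B := fun B hB =>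
      (gt_mem_nhds hB).filter_mono nhdsWithin_le_nhds
    exact (eventually_mem_nhdsWithin.and ((hlt 1 one_pos).and ((hlt R₁ hR₁).and
      ((hlt (R₂ / 2) (by positivity)).and ((hlim K).and (hlim (K * k * A))))))).exists
  have hRball : Metric.closedBall x₀ R ⊆ Metric.ball x₀ R₁ := Metric.closedBall_subset_ball hRR₁
  have hRΩ : Metric.closedBall x₀ R ⊆ Ω := fun z hz => (hball z (hRball hz)).2
  obtain ⟨ε, m, hε, x, hx, hxu, hmin⟩ := exists_touching_logBarrier (A := A)
    hE.isCompact.isClosed hu.lowerSemicontinuousOn hx₀E hR hR1.le hc0 hA0 hRΩ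
    (hφ.continuousOn.mono hRΩ) hle heq
  have hxR : dist x x₀ < R := hx.1
  have hxΩ : x ∈ Ω := hRΩ (Metric.ball_subset_closedBall hx.1)
  obtain ⟨y, hy, hxy⟩ := hE.isCompact.exists_infDist_eq_dist ⟨x₀, hx₀E⟩ x
  have hnear : ∀ y' ∈ E, dist x y ≤ dist x y' := fun y' hy' =>
    hxy ▸ Metric.infDist_le_dist_of_mem hy'
  have hr : dist x y < R := (hnear x₀ hx₀E).trans_lt hxR
  have hne : x ≠ y := fun h => hx.2 (h ▸ hy)
  obtain ⟨T, hT, hflat, hperp⟩ := htan y hy (by linarith [dist_triangle_left y x₀ x])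
  have hP := hperp x hnear
  let Q : EuclideanSpace ℝ (Fin n) → ℝ := fun z =>
    ‖z - y‖ ^ 2 - (1 + K * dist x y) * ‖T.starProjection (z - y)‖ ^ 2
  have hQx : Q x = dist x y ^ 2 := by
    simp only [Q, hP, norm_zero, dist_eq_norm]
    ring
  have hQ : ContDiff ℝ 2 Q :=
    ((contDiff_id.sub contDiff_const).norm_sq ℝ).sub (contDiff_const.mul
      ((T.starProjection.contDiff.comp (contDiff_id.sub contDiff_const)).norm_sq ℝ))
  have hQpos : 0 < Q x := by rw [hQx]; exact pow_pos (dist_pos.2 hne) 2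
  have hQle : ∀ᶠ z in 𝓝 x, Q z ≤ Metric.infDist z E ^ 2 :=
    eventually_norm_sq_sub_le_infDist_sq hE.isCompact hx₀E hy hne T hC
      ((mul_le_mul_of_nonneg_left hr.le hK0).trans hKR.le) (hxR.trans hRR₂) hflat
  have hbar : ContDiffAt ℝ 2 (fun z => logBarrier A (Q z)) x :=
    (contDiffAt_logBarrier A hQpos).comp x hQ.contDiffAt
  have hsq : ContDiffAt ℝ 2 (fun z : EuclideanSpace ℝ (Fin n) => -c * ‖z - x₀‖ ^ 2) x :=
    (contDiff_const.mul ((contDiff_id.sub contDiff_const).norm_sq ℝ)).contDiffAt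
  have hεbar : ContDiffAt ℝ 2 (fun z => ε * logBarrier A (Q z)) x := contDiffAt_const.mul hbar
  -- Since the barrier profile is increasing, replacing the squared distance by `Q` keeps the
  -- function below `u` near `x` and preserves contact there, while making it `C²` at `x`.
  let ψ : EuclideanSpace ℝ (Fin n) → ℝ := fun z =>
    φ z + -c * ‖z - x₀‖ ^ 2 + ε * logBarrier A (Q z) + m
  have hψ : ContDiffAt ℝ 2 ψ x :=
    (((hφat x hxΩ).add hsq).add hεbar).add contDiffAt_const
  have hψle : ∀ᶠ z in 𝓝 x, (ψ z : EReal) ≤ u z := by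
    filter_upwards [hQle, hQ.continuous.continuousAt.eventually (lt_mem_nhds hQpos),
      (Metric.isOpen_ball.sdiff hE.isCompact.isClosed).mem_nhds hx] with z hz hz0 hzR
    refine le_trans (EReal.coe_le_coe_iff.2 ?_) (hmin z hzR)
    have := mul_le_mul_of_nonneg_left (logBarrier_mono hA0 hz0 hz) hε.le
    simp only [ψ]
    linarith
  have hψx : (ψ x : EReal) = u x := by
    rw [← hxu, EReal.coe_eq_coe_iff, hxy, ← hQx]
    simp only [ψ]
    ring
  have hneg := hu.hessian_le_of_eventually ⟨hxΩ, hx.2⟩ hψ hψle hψx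
  obtain ⟨v, hv, hsum⟩ := exists_orthonormal_sum_eq_sumSmallestEigenvalues hkn
    (hessianMatrix_isHermitian hψ)
  rw [← hsum] at hneg
  simp_rw [inner_toEuclideanLin_hessianMatrix] at hneg
  have hψ2 : ∀ v, ε * fderiv ℝ (fderiv ℝ fun z => logBarrier A (Q z)) x v v ≤
      fderiv ℝ (fderiv ℝ ψ) x v v := by
    intro v
    have h₁ : fderiv ℝ ψ = fderiv ℝ fun z =>
        φ z + -c * ‖z - x₀‖ ^ 2 + ε * logBarrier A (Q z) := by
      ext1 z
      exact fderiv_add_const m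
    rw [h₁, fderiv_fderiv_add_apply ((hφat x hxΩ).add hsq) hεbar,
      fderiv_fderiv_add_apply (hφat x hxΩ) hsq, fderiv_fderiv_norm_sub_sq,
      fderiv_fderiv_const_mul_apply _ hbar]
    linarith [(hball x (hRball (Metric.ball_subset_closedBall hx.1))).1 v]
  have hbarpos : 0 < ∑ i, fderiv ℝ (fderiv ℝ fun z => logBarrier A (Q z)) x (v i) (v i) :=
    sum_fderiv_fderiv_logBarrier_pos hv T hT hK0 hA hne hP
      ((mul_le_mul_of_nonneg_left hr.le (by positivity)).trans_lt hKAR)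
  have := (mul_pos hε hbarpos).trans_le
    ((Finset.mul_sum _ _ _).trans_le (Finset.sum_le_sum fun i _ => hψ2 (v i)))
  linarith

theorem theorem10p1 (n k : ℕ) (hkn : k + 2 ≤ n)
    (Ω E : Set (EuclideanSpace ℝ (Fin n)))
    (hΩ : IsOpen Ω) (hΩb : Bornology.IsBounded Ω)
    (hE : IsSmoothClosedSubmanifold k E)
    (u : EuclideanSpace ℝ (Fin n) → EReal)
    (hu : IsViscositySuperaffine (k + 2) (Ω \ E) u) :
    IsViscositySuperaffine 1 Ω (liminfExtension Ω E u) := by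
  refine ⟨lowerSemicontinuousOn_liminfExtension hΩ hE.isCompact.isClosed
    hu.lowerSemicontinuousOn, ?_, fun φ hφ hle x₀ hx₀ heq => ?_⟩
  · obtain ⟨c, hc⟩ := hu.bddBelow
    exact ⟨c, fun x hx => le_liminfExtension hc hx⟩
  · have hle' : ∀ x ∈ Ω \ E, (φ x : EReal) ≤ u x := fun x hx => by
      simpa only [liminfExtension_of_notMem hx.2] using hle x hx.1
    by_cases hx₀E : x₀ ∈ E
    · rw [liminfExtension_of_mem hx₀E] at heq
      exact sumSmallestEigenvalues_one_nonpos_of_touching hkn hΩ hE hu hφ hle' hx₀ hx₀E heq.symm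
    · rw [liminfExtension_of_notMem hx₀E] at heq
      exact sumSmallestEigenvalues_one_nonpos (by omega)
        (hu.hessian_le φ (hφ.mono sdiff_subset) hle' x₀ ⟨hx₀, hx₀E⟩ heq)
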